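/- Let $\Delta\ge 0$, let $\mathcal X^n=C([-\Delta,0];\mathbb R^n)$ with the supremum norm $\|\cdot\|$ (for the Euclidean norm $|\cdot|$ on $\mathbb R^n$), and let $\mathcal W^n\subset\mathcal X^n$ be the set of absolutely continuous functions with essentially bounded derivative. Let $\mathcal U^m$ be the set of Lebesgue measurable, locally essentially bounded $u:[0,\infty)\to\mathbb R^m$, and write $\|u_{[0,t]}\|$ for the essential supremum of $|u|$ over $[0,t]$. Let $\mathcal N$ be the set of continuous non-decreasing functions $\mu:[0,\infty)\to[0,\infty)$ with $\mu(0)=0$. Let $f:\mathcal X^n\times\mathbb R^m\to\mathbb R^n$ be Lipschitz on bounded sets with $f(0,0)=0$, and consider the time-delay system $$\dot x(t)=f(x_t,u(t)),\qquad x_t(\tau):=x(t+\tau)\ \ (\tau\in[-\Delta,0]),\tag{1}$$ with solutions understood in the Carathéodory sense (continuous $x$ with $x(t)=x(0)+\int_0^t f(x_s,u(s))\,ds$). System (1) is called *exp-ISS* if there exist $k,\eta>0$ and $\mu\in\mathcal N$ such that, for all $x_0\in\mathcal X^n$ and $u\in\mathcal U^m$, the corresponding solution exists on $[0,\infty)$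 and satisfies $|x(t)|\le k\|x_0\|e^{-\eta t}+\mu(\|u_{[0,t]}\|)$ for all $t\ge 0$; it is *exp-ISS with linear gain* if this holds with $\mu(s)=\mu_0 s$ for some $\mu_0\ge 0$. Then (1) is exp-ISS if and only if there exist $\ell,T>0$, $\lambda\in(0,1)$ and $\mu\in\mathcal N$ such that, for all $x_0\in\mathcal W^n$ and all $u\in\mathcal U^m$, the corresponding solution exists on $[0,T]$ and satisfies $$\|x_t\|\le \ell\|x_0\|+\mu(\|u_{[0,t]}\|)\quad\text{for all } t\in[0,T],\qquad \|x_T\|\le\lambda\|x_0\|+\mu(\|u_{[0,T]}\|).$$ Moreover, (1) is exp-ISS with linear gain if and only if the same holds with a linear $\mu$, i.e. $\mu(s)=\mu_0 s$ for some $\mu_0\ge 0$. -/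

import Mathlib

open MeasureTheory Set
open scoped NNReal ENNReal

noncomputable section

namespace DelaySystem

/-- State space of continuous histories on `[-Δ, 0]` with values in `ℝⁿ` (Euclidean norm),
with the supremum norm. -/
abbrev History (Δ : ℝ≥0) (n : ℕ) : Type :=
  C(Icc (-(Δ : ℝ)) 0, EuclideanSpace ℝ (Fin n))

/-- The history `x_t`, `x_t(τ) = x(t + τ)` for `τ ∈ [-Δ, 0]`. -/
def historyAt (Δ : ℝ≥0) {n : ℕ} (x : C(ℝ, EuclideanSpace ℝ (Fin n))) (t : ℝ) :
    History Δ n where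
  toFun τ := x (t + τ)
  continuous_toFun := by fun_prop

/-- The extension of a history to `ℝ` that is constant on each side of `[-Δ, 0]`. -/
def historyExtend {Δ : ℝ≥0} {n : ℕ} (φ : History Δ n) : ℝ → EuclideanSpace ℝ (Fin n) :=
  IccExtend (neg_nonpos.mpr Δ.coe_nonneg) φ

/-- Membership in `W^{1,∞}`: absolutely continuous on `[-Δ, 0]` with essentially bounded
derivative. -/
def IsSobolev {Δ : ℝ≥0} {n : ℕ} (φ : History Δ n) : Prop :=
  AbsolutelyContinuousOnInterval (historyExtend φ) (-(Δ : ℝ)) 0 ∧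
    ∃ C : ℝ, ∀ᵐ τ ∂volume.restrict (Icc (-(Δ : ℝ)) 0), ‖deriv (historyExtend φ) τ‖ ≤ C

/-- Lebesgue measurable, locally essentially bounded signals on `[0, ∞)`; values at negative
times play no role. -/
def IsInput {m : ℕ} (u : ℝ → EuclideanSpace ℝ (Fin m)) : Prop :=
  ∀ t : ℝ, 0 ≤ t → MemLp u ∞ (volume.restrict (Icc 0 t))

/-- `‖u_{[0,t]}‖`, the essential supremum of `|u|` on `[0, t]` (it is `0` for `t = 0`). -/
def inputNorm {m : ℕ} (u : ℝ → EuclideanSpace ℝ (Fin m)) (t : ℝ) : ℝ≥0 :=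
  (eLpNorm u ∞ (volume.restrict (Icc 0 t))).toNNReal

/-- Class `𝒩`: continuous, non-decreasing, zero at zero. -/
structure IsClassN (μ : ℝ≥0 → ℝ≥0) : Prop where
  continuous : Continuous μ
  monotone : Monotone μ
  map_zero : μ 0 = 0

/-- `μ(s) = μ₀ s` for some `μ₀ ≥ 0`. -/
def IsLinearGain (μ : ℝ≥0 → ℝ≥0) : Prop :=
  ∃ μ₀ : ℝ≥0, ∀ s : ℝ≥0, μ s = μ₀ * s

def LipschitzOnBounded {Δ : ℝ≥0} {n m : ℕ}
    (f : History Δ n × EuclideanSpace ℝ (Fin m) → EuclideanSpace ℝ (Fin n)) : Prop :=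
  ∀ B : Set (History Δ n × EuclideanSpace ℝ (Fin m)), Bornology.IsBounded B →
    ∃ K : ℝ≥0, LipschitzOnWith K f B

/-- `x` is a (Carathéodory) solution of `ẋ(t) = f(x_t, u(t))` with `x₀ = φ` on the time interval
`J`, used for `J = [0, T]` and `J = [0, ∞)`. Such a solution is a continuous function on
`[-Δ, T]`, resp. `[-Δ, ∞)`; it is represented by a continuous extension to `ℝ`, whose values
outside that interval are unconstrained. -/
structure IsSolution {Δ : ℝ≥0} {n m : ℕ}
    (f : History Δ n × EuclideanSpace ℝ (Fin m) → EuclideanSpace ℝ (Fin n))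
    (φ : History Δ n) (u : ℝ → EuclideanSpace ℝ (Fin m)) (J : Set ℝ)
    (x : C(ℝ, EuclideanSpace ℝ (Fin n))) : Prop where
  init : historyAt Δ x 0 = φ
  integrable : ∀ t ∈ J, IntervalIntegrable (fun s => f (historyAt Δ x s, u s)) volume 0 t
  eq_integral : ∀ t ∈ J, x t = x 0 + ∫ s in (0 : ℝ)..t, f (historyAt Δ x s, u s)

/-- The solution starting from `φ` under the input `u` exists on `J` and satisfies `P`. -/
def SolutionSatisfies {Δ : ℝ≥0} {n m : ℕ}
    (f : History Δ n × EuclideanSpace ℝ (Fin m) → EuclideanSpace ℝ (Fin n))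
    (φ : History Δ n) (u : ℝ → EuclideanSpace ℝ (Fin m)) (J : Set ℝ)
    (P : C(ℝ, EuclideanSpace ℝ (Fin n)) → Prop) : Prop :=
  (∃ x, IsSolution f φ u J x) ∧ ∀ x, IsSolution f φ u J x → P x

/-- The exp-ISS estimate holds with gain `μ` for some `k, η > 0`. -/
def ExpISSWithGain {Δ : ℝ≥0} {n m : ℕ}
    (f : History Δ n × EuclideanSpace ℝ (Fin m) → EuclideanSpace ℝ (Fin n))
    (μ : ℝ≥0 → ℝ≥0) : Prop :=
  ∃ k η : ℝ, 0 < k ∧ 0 < η ∧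
    ∀ (φ : History Δ n) (u : ℝ → EuclideanSpace ℝ (Fin m)), IsInput u →
      SolutionSatisfies f φ u (Ici 0) fun x =>
        ∀ t : ℝ, 0 ≤ t → ‖x t‖ ≤ k * ‖φ‖ * Real.exp (-η * t) + μ (inputNorm u t)

/-- Exponential input-to-state stability. -/
def ExpISS {Δ : ℝ≥0} {n m : ℕ}
    (f : History Δ n × EuclideanSpace ℝ (Fin m) → EuclideanSpace ℝ (Fin n)) : Prop :=
  ∃ μ : ℝ≥0 → ℝ≥0, IsClassN μ ∧ ExpISSWithGain f μ

/-- Exponential input-to-state stability with linear gain. -/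
def ExpISSLinearGain {Δ : ℝ≥0} {n m : ℕ}
    (f : History Δ n × EuclideanSpace ℝ (Fin m) → EuclideanSpace ℝ (Fin n)) : Prop :=
  ∃ μ : ℝ≥0 → ℝ≥0, IsClassN μ ∧ IsLinearGain μ ∧ ExpISSWithGain f μ

/-- For every `W^{1,∞}` initial state and every input, the solution exists on `[0, T]` and
satisfies `‖x_t‖ ≤ ℓ ‖x₀‖ + μ(‖u_{[0,t]}‖)` on `[0, T]` and
`‖x_T‖ ≤ lam ‖x₀‖ + μ(‖u_{[0,T]}‖)`. -/
def FiniteTimeEstimates {Δ : ℝ≥0} {n m : ℕ}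
    (f : History Δ n × EuclideanSpace ℝ (Fin m) → EuclideanSpace ℝ (Fin n))
    (ℓ T lam : ℝ) (μ : ℝ≥0 → ℝ≥0) : Prop :=
  ∀ (φ : History Δ n) (u : ℝ → EuclideanSpace ℝ (Fin m)), IsSobolev φ → IsInput u →
    SolutionSatisfies f φ u (Icc 0 T) fun x =>
      (∀ t ∈ Icc (0 : ℝ) T, ‖historyAt Δ x t‖ ≤ ℓ * ‖φ‖ + μ (inputNorm u t)) ∧
      ‖historyAt Δ x T‖ ≤ lam * ‖φ‖ + μ (inputNorm u T)

end DelaySystem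

end

/-! From exp-ISS to the finite-time estimates, take the horizon longer than the delay by enough for
the whole final history to lie where the exponential has decayed. The gain is unchanged.

Conversely, iterate the contraction over windows of length `T`: the sampled norms decay like `lam ^
j`, the input terms sum to a geometric series, and the bound with `ℓ` fills the gaps between
samples. Each restart is a translate of the system, whose input norm is at most that of the original
input.

The obstacle is that the estimates are given only for Sobolev initial histories, while histories at
restart times are merely continuous. Lipschitz functions are dense, and the estimate with `ℓ` bounds
the approximating solutions uniformly. On the resulting bounded set `f` is Lipschitz, so Grönwall
makes these solutions Cauchy. Their limit is a solution and inherits the estimates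
(`exists_isSolution_of_tendsto`, `FiniteTimeEstimates.of_continuous`). Concatenation then gives
global existence.

The gain only gets multiplied by a constant, which preserves linearity, so both equivalences follow
at once. -/

open Filter Topology

namespace DelaySystem

variable {Δ : ℝ≥0} {n m : ℕ}

/-! ### Histories and density of Lipschitz functions -/

section Histories

@[simp]
lemma historyAt_apply (x : C(ℝ, EuclideanSpace ℝ (Fin n))) (t : ℝ)
    (τ : Icc (-(Δ : ℝ)) 0) : historyAt Δ x t τ = x (t + τ) := rfl

lemma continuous_historyAt (x : C(ℝ, EuclideanSpace ℝ (Fin n))) :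
    Continuous (historyAt Δ x) := by
  apply ContinuousMap.continuous_of_continuous_uncurry
  change Continuous fun p : ℝ × Icc (-(Δ : ℝ)) 0 => x (p.1 + p.2)
  fun_prop

lemma norm_apply_le_norm_historyAt (x : C(ℝ, EuclideanSpace ℝ (Fin n))) (t : ℝ) :
    ‖x t‖ ≤ ‖historyAt Δ x t‖ := by
  simpa using (historyAt Δ x t).norm_coe_le_norm ⟨0, by simp⟩

lemma historyAt_congr {x y : C(ℝ, EuclideanSpace ℝ (Fin n))} {s t : ℝ}
    (h : ∀ τ ∈ Icc (-(Δ : ℝ)) 0, x (s + τ) = y (t + τ)) :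
    historyAt Δ x s = historyAt Δ y t := by
  ext1 τ
  exact h τ τ.2

/-- The translate of a trajectory by `a` units of time. -/
def timeShift (a : ℝ) (x : C(ℝ, EuclideanSpace ℝ (Fin n))) :
    C(ℝ, EuclideanSpace ℝ (Fin n)) where
  toFun t := x (t + a)
  continuous_toFun := by fun_prop

lemma historyAt_timeShift (a : ℝ) (x : C(ℝ, EuclideanSpace ℝ (Fin n))) (t : ℝ) :
    historyAt Δ (timeShift a x) t = historyAt Δ x (t + a) := by
  ext1 τ
  change x (t + τ + a) = x (t + a + τ)
  congr 1
  ring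

lemma exists_norm_historyAt_le (x : C(ℝ, EuclideanSpace ℝ (Fin n))) (T : ℝ) :
    ∃ R : ℝ, ∀ t ∈ Icc 0 T, ‖historyAt Δ x t‖ ≤ R :=
  isCompact_Icc.exists_bound_of_continuousOn (continuous_historyAt x).continuousOn

lemma isSobolev_of_lipschitzWith {φ : History Δ n} {K : ℝ≥0} (h : LipschitzWith K φ) :
    IsSobolev φ := by
  have hext : LipschitzWith (K * 1) (historyExtend φ) := h.comp (LipschitzWith.projIcc _)
  exact ⟨hext.lipschitzOnWith.absolutelyContinuousOnInterval,
    _, ae_of_all _ fun _ => norm_deriv_le_of_lipschitz hext⟩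

/-- Forward averages over length `h` of the constant extension are Lipschitz because the extension
is bounded. They are uniformly close to `φ` once `h` is below its modulus of continuity at `ε`. -/
lemma exists_isSobolev_dist_le (φ : History Δ n) {ε : ℝ} (hε : 0 < ε) :
    ∃ ψ : History Δ n, IsSobolev ψ ∧ dist ψ φ ≤ ε := by
  set F := historyExtend φ with hF
  have hFu : UniformContinuous F :=
    (CompactSpace.uniformContinuous_of_continuous φ.continuous).comp
      (LipschitzWith.projIcc _).uniformContinuous
  have hFc : Continuous F := hFu.continuous
  have hFb : ∀ t, ‖F t‖ ≤ ‖φ‖ := fun t => φ.norm_coe_le_norm _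
  have hFi : ∀ a b, IntervalIntegrable F volume a b := fun a b => hFc.intervalIntegrable a b
  obtain ⟨δ, hδ, hδε⟩ := Metric.uniformContinuous_iff.1 hFu ε hε
  obtain ⟨h, hh, hhδ⟩ := exists_between hδ
  have hG : LipschitzWith (Real.toNNReal (h⁻¹ * (2 * ‖φ‖)))
      fun t : ℝ => h⁻¹ • ∫ s in t..t + h, F s := by
    refine LipschitzWith.of_dist_le' fun t s => ?_
    rw [dist_eq_norm, ← smul_sub, norm_smul, Real.norm_of_nonneg (inv_nonneg.2 hh.le), mul_assoc]
    refine mul_le_mul_of_nonneg_left ?_ (inv_nonneg.2 hh.le)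
    -- The common part cancels, leaving two end intervals of length `|t - s|`.
    rw [intervalIntegral.integral_interval_sub_interval_comm (hFi _ _) (hFi _ _) (hFi _ _)]
    have h1 := intervalIntegral.norm_integral_le_of_norm_le_const
      (a := t) (b := s) (fun r _ => hFb r)
    have h2 := intervalIntegral.norm_integral_le_of_norm_le_const
      (a := t + h) (b := s + h) (fun r _ => hFb r)
    rw [add_sub_add_right_eq_sub] at h2
    rw [Real.dist_eq, abs_sub_comm t s]
    calc _ ≤ _ := norm_sub_le _ _
      _ ≤ _ := add_le_add h1 h2
      _ = _ := by ring
  let ψ : History Δ n := ⟨fun t => h⁻¹ • ∫ s in (t : ℝ)..t + h, F s,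
    hG.continuous.comp continuous_subtype_val⟩
  refine ⟨ψ, isSobolev_of_lipschitzWith (hG.comp (LipschitzWith.subtype_val _)), ?_⟩
  refine (ContinuousMap.dist_le hε.le).2 fun t => ?_
  have ht : φ t = h⁻¹ • ∫ _ in (t : ℝ)..t + h, F t := by
    rw [intervalIntegral.integral_const, add_sub_cancel_left, smul_smul,
      inv_mul_cancel₀ hh.ne', one_smul, hF, historyExtend, IccExtend_val]
  change dist (h⁻¹ • ∫ s in (t : ℝ)..t + h, F s) _ ≤ ε
  rw [ht, dist_eq_norm, ← smul_sub, ← intervalIntegral.integral_sub (hFi _ _)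
    intervalIntegrable_const, norm_smul, Real.norm_of_nonneg (inv_nonneg.2 hh.le),
    inv_mul_le_iff₀ hh]
  have := intervalIntegral.norm_integral_le_of_norm_le_const (C := ε)
    (f := fun s => F s - F t) (a := t) (b := t + h) fun s hs => by
      rw [uIoc_of_le (by linarith)] at hs
      rw [← dist_eq_norm]
      refine (hδε ?_).le
      rw [Real.dist_eq, abs_of_pos (by linarith [hs.1])]
      linarith [hs.2]
  rwa [add_sub_cancel_left, abs_of_pos hh, mul_comm] at this

lemma exists_seq_isSobolev_tendsto (φ : History Δ n) :
    ∃ ψ : ℕ → History Δ n, (∀ j, IsSobolev (ψ j)) ∧ Tendsto ψ atTop (𝓝 φ) := by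
  choose ψ hψ hd using fun j : ℕ =>
    exists_isSobolev_dist_le φ (Nat.one_div_pos_of_nat (α := ℝ) (n := j))
  exact ⟨ψ, hψ, tendsto_iff_dist_tendsto_zero.2 <|
    squeeze_zero (fun _ => dist_nonneg) hd tendsto_one_div_add_atTop_nhds_zero_nat⟩

end Histories

/-! ### Input norms under restriction and translation -/

section Inputs

variable {u : ℝ → EuclideanSpace ℝ (Fin m)}

lemma IsInput.ae_norm_le (hu : IsInput u) {t : ℝ} (ht : 0 ≤ t) :
    ∀ᵐ s, s ∈ Icc 0 t → ‖u s‖ ≤ inputNorm u t := by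
  rw [← ae_restrict_iff' measurableSet_Icc]
  filter_upwards [ae_le_eLpNormEssSup (f := u) (μ := volume.restrict (Icc 0 t))] with s hs
  rw [← eLpNorm_exponent_top, ← ENNReal.coe_toNNReal (hu t ht).eLpNorm_ne_top] at hs
  exact_mod_cast hs

lemma IsInput.inputNorm_mono (hu : IsInput u) {s t : ℝ} (ht : 0 ≤ t) (hst : s ≤ t) :
    inputNorm u s ≤ inputNorm u t :=
  ENNReal.toNNReal_mono (hu t ht).eLpNorm_ne_top <|
    eLpNorm_mono_measure _ (Measure.restrict_mono (Icc_subset_Icc_right hst) le_rfl)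

lemma measurePreserving_add_right_restrict_Icc (a t : ℝ) :
    MeasurePreserving (fun s : ℝ => s + a) (volume.restrict (Icc 0 t))
      (volume.restrict (Icc a (t + a))) := by
  convert (measurePreserving_add_right volume a).restrict_preimage
    (measurableSet_Icc (a := a) (b := t + a)) using 2
  simp

lemma IsInput.memLp_Icc (hu : IsInput u) {a t : ℝ} (ha : 0 ≤ a) (ht : 0 ≤ t) :
    MemLp u ∞ (volume.restrict (Icc a (t + a))) :=
  (hu (t + a) (by positivity)).mono_measure
    (Measure.restrict_mono (Icc_subset_Icc_left ha) le_rfl)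

lemma IsInput.comp_add_right (hu : IsInput u) {a : ℝ} (ha : 0 ≤ a) :
    IsInput fun s => u (s + a) := fun t ht =>
  (hu.memLp_Icc ha ht).comp_measurePreserving (measurePreserving_add_right_restrict_Icc a t)

lemma IsInput.inputNorm_comp_add_right_le (hu : IsInput u) {a t : ℝ} (ha : 0 ≤ a)
    (ht : 0 ≤ t) : inputNorm (fun s => u (s + a)) t ≤ inputNorm u (t + a) := by
  refine ENNReal.toNNReal_mono (hu (t + a) (by positivity)).eLpNorm_ne_top ?_
  calc eLpNorm (fun s => u (s + a)) ∞ (volume.restrict (Icc 0 t))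
      = eLpNorm u ∞ (volume.restrict (Icc a (t + a))) :=
        eLpNorm_comp_measurePreserving (hu.memLp_Icc ha ht).aestronglyMeasurable
          (measurePreserving_add_right_restrict_Icc a t)
    _ ≤ _ := eLpNorm_mono_measure _
        (Measure.restrict_mono (Icc_subset_Icc_left ha) le_rfl)

end Inputs

/-! ### Bounds and integrability of the vector field along trajectories -/

section VectorField

variable {f : History Δ n × EuclideanSpace ℝ (Fin m) → EuclideanSpace ℝ (Fin n)}
  {u : ℝ → EuclideanSpace ℝ (Fin m)}

lemma LipschitzOnBounded.exists_lipschitzOnWith (hf : LipschitzOnBounded f) (R M : ℝ) :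
    ∃ K : ℝ≥0, LipschitzOnWith K f (Metric.closedBall 0 R ×ˢ Metric.closedBall 0 M) :=
  hf _ (Metric.isBounded_closedBall.prod Metric.isBounded_closedBall)

lemma LipschitzOnBounded.continuous (hf : LipschitzOnBounded f) : Continuous f := by
  refine continuous_iff_continuousAt.2 fun p => ?_
  obtain ⟨K, hK⟩ := hf (Metric.ball p 1) Metric.isBounded_ball
  exact hK.continuousOn.continuousAt (Metric.ball_mem_nhds p one_pos)

lemma aestronglyMeasurable_vectorField (hf : LipschitzOnBounded f) (hu : IsInput u)
    (x : C(ℝ, EuclideanSpace ℝ (Fin n))) {t : ℝ} (ht : 0 ≤ t) :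
    AEStronglyMeasurable (fun s => f (historyAt Δ x s, u s)) (volume.restrict (Icc 0 t)) :=
  hf.continuous.comp_aestronglyMeasurable <|
    (continuous_historyAt x).aestronglyMeasurable.prodMk (hu t ht).aestronglyMeasurable

/-- The vector field is essentially bounded along trajectories with uniformly bounded
histories. -/
lemma exists_norm_vectorField_le (hf : LipschitzOnBounded f) (hu : IsInput u) {T : ℝ}
    (hT : 0 ≤ T) (R : ℝ) :
    ∃ C : ℝ, ∀ᵐ s, s ∈ Icc 0 T → ∀ φ : History Δ n, ‖φ‖ ≤ R → ‖f (φ, u s)‖ ≤ C := by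
  obtain ⟨K, hK⟩ := hf.exists_lipschitzOnWith R (inputNorm u T)
  refine ⟨‖f 0‖ + K * max R (inputNorm u T), ?_⟩
  -- The exceptional null set depends only on `u`, so one bound serves all approximating
  -- trajectories at once.
  filter_upwards [hu.ae_norm_le hT] with s hs hsT φ hφ
  have hsub := hK.norm_sub_le (x := (φ, u s)) (y := 0)
    ⟨by simpa using hφ, by simpa using hs hsT⟩
    ⟨by simpa using (norm_nonneg φ).trans hφ, by simp⟩
  have hle : ‖(φ, u s) - 0‖ ≤ max R (inputNorm u T) := by
    rw [sub_zero, Prod.norm_def]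
    exact max_le_max hφ (hs hsT)
  calc ‖f (φ, u s)‖ ≤ ‖f 0‖ + ‖f (φ, u s) - f 0‖ := norm_le_norm_add_norm_sub' _ _
    _ ≤ _ := by grw [hsub, hle]

/-- Only continuity of `x` is needed, so glued trajectories and limits are covered before they are
known to be solutions. -/
lemma intervalIntegrable_vectorField (hf : LipschitzOnBounded f) (hu : IsInput u)
    (x : C(ℝ, EuclideanSpace ℝ (Fin n))) {t : ℝ} (ht : 0 ≤ t) :
    IntervalIntegrable (fun s => f (historyAt Δ x s, u s)) volume 0 t := by
  obtain ⟨R, hR⟩ := exists_norm_historyAt_le (Δ := Δ) x t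
  obtain ⟨C, hC⟩ := exists_norm_vectorField_le hf hu ht R
  rw [intervalIntegrable_iff_integrableOn_Icc_of_le ht]
  refine Integrable.of_bound (aestronglyMeasurable_vectorField hf hu x ht) C ?_
  rw [ae_restrict_iff' measurableSet_Icc]
  filter_upwards [hC] with s hs hst using hs hst _ (hR s hst)

end VectorField

/-- Integral form of Grönwall's inequality with a constant forcing term. -/
lemma le_mul_exp_of_le_add_mul_integral {g : ℝ → ℝ} (hg : Continuous g) (hg0 : ∀ t, 0 ≤ g t)
    {ε K T : ℝ} (hK : 0 ≤ K) (h : ∀ t ∈ Icc 0 T, g t ≤ ε + K * ∫ s in (0 : ℝ)..t, g s) :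
    ∀ t ∈ Icc 0 T, g t ≤ ε * Real.exp (K * t) := by
  intro t ht
  rcases hK.eq_or_lt with rfl | hK
  · simpa using h t ht
  have hpos : ∀ t, 0 ≤ t → 0 ≤ ∫ s in (0 : ℝ)..t, g s := fun t ht =>
    intervalIntegral.integral_nonneg ht fun s _ => hg0 s
  have hderiv : ∀ t, HasDerivAt (fun r => ∫ s in (0 : ℝ)..r, g s) (g t) t := fun t =>
    (hg.integral_hasStrictDerivAt 0 t).hasDerivAt
  -- The differential form is applied to the primitive of `g`, since `g` itself need not be
  -- differentiable.
  have key := norm_le_gronwallBound_of_norm_deriv_right_le (δ := 0) (K := K) (ε := ε)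
    (fun t _ => (hderiv t).continuousAt.continuousWithinAt)
    (fun t _ => (hderiv t).hasDerivWithinAt) (by simp)
    (fun s hs => by
      rw [Real.norm_of_nonneg (hg0 s), Real.norm_of_nonneg (hpos s hs.1), add_comm]
      exact h s (Ico_subset_Icc_self hs)) t ht
  rw [Real.norm_of_nonneg (hpos t ht.1), gronwallBound_of_K_ne_0 hK.ne', sub_zero] at key
  simp only [zero_mul, zero_add] at key
  calc g t ≤ ε + K * ∫ s in (0 : ℝ)..t, g s := h t ht
    _ ≤ ε + K * (ε / K * (Real.exp (K * t) - 1)) := by gcongr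
    _ = ε * Real.exp (K * t) := by field_simp; ring

/-! ### Continuous dependence, uniqueness, restarting and concatenation -/

section Solutions

variable {f : History Δ n × EuclideanSpace ℝ (Fin m) → EuclideanSpace ℝ (Fin n)}
  {u : ℝ → EuclideanSpace ℝ (Fin m)} {φ ψ : History Δ n}
  {x y : C(ℝ, EuclideanSpace ℝ (Fin n))}

lemma IsSolution.mono {J J' : Set ℝ} (hx : IsSolution f φ u J x) (h : J' ⊆ J) :
    IsSolution f φ u J' x :=
  ⟨hx.init, fun t ht => hx.integrable t (h ht), fun t ht => hx.eq_integral t (h ht)⟩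

lemma IsSolution.apply_eq {J : Set ℝ} (hx : IsSolution f φ u J x) {τ : ℝ}
    (hτ : τ ∈ Icc (-(Δ : ℝ)) 0) : x τ = φ ⟨τ, hτ⟩ := by
  simpa using DFunLike.congr_fun hx.init ⟨τ, hτ⟩

/-- Solutions depend Lipschitz continuously on the initial history, with a constant governed by
the bounds on the trajectories. -/
lemma IsSolution.norm_historyAt_sub_le {T R M : ℝ} {K : ℝ≥0}
    (hK : LipschitzOnWith K f (Metric.closedBall 0 R ×ˢ Metric.closedBall 0 M))
    (hx : IsSolution f φ u (Icc 0 T) x) (hy : IsSolution f ψ u (Icc 0 T) y)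
    (hxR : ∀ t ∈ Icc 0 T, ‖historyAt Δ x t‖ ≤ R) (hyR : ∀ t ∈ Icc 0 T, ‖historyAt Δ y t‖ ≤ R)
    (hu : ∀ᵐ s, s ∈ Icc 0 T → ‖u s‖ ≤ M) :
    ∀ t ∈ Icc 0 T, ‖historyAt Δ x t - historyAt Δ y t‖ ≤ ‖φ - ψ‖ * Real.exp (K * t) := by
  have hg : Continuous fun t => ‖historyAt Δ x t - historyAt Δ y t‖ :=
    ((continuous_historyAt (Δ := Δ) x).sub (continuous_historyAt y)).norm
  refine le_mul_exp_of_le_add_mul_integral hg (fun _ => norm_nonneg _) K.coe_nonneg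
    fun t ht => ?_
  have hpos : ∀ r, 0 ≤ r → 0 ≤ ∫ s in (0 : ℝ)..r, ‖historyAt Δ x s - historyAt Δ y s‖ :=
    fun r hr => intervalIntegral.integral_nonneg hr fun s _ => norm_nonneg _
  have hinit : ∀ τ ∈ Icc (-(Δ : ℝ)) 0, ‖x τ - y τ‖ ≤ ‖φ - ψ‖ := fun τ hτ => by
    rw [hx.apply_eq hτ, hy.apply_eq hτ]
    exact (φ - ψ).norm_coe_le_norm ⟨τ, hτ⟩
  have hpost := hpos t ht.1
  refine (ContinuousMap.norm_le _ (by positivity)).2 fun τ => ?_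
  change ‖x (t + τ) - y (t + τ)‖ ≤ _
  -- The window may still overlap the initial history; there `‖φ - ψ‖` suffices. Elsewhere the
  -- integral equation applies, and the integral up to `t + τ` is enlarged to one up to `t`.
  rcases le_total (t + τ : ℝ) 0 with h0 | h0
  · have := hinit (t + τ) ⟨by linarith [τ.2.1, ht.1], h0⟩
    exact this.trans (le_add_of_nonneg_right (by positivity))
  set r : ℝ := t + τ with hr
  have hrt : r ≤ t := by linarith [τ.2.2]
  have hrT : r ∈ Icc 0 T := ⟨h0, hrt.trans ht.2⟩
  have hint : ‖∫ s in (0 : ℝ)..r, (f (historyAt Δ x s, u s) - f (historyAt Δ y s, u s))‖ ≤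
      ∫ s in (0 : ℝ)..r, K * ‖historyAt Δ x s - historyAt Δ y s‖ := by
    refine intervalIntegral.norm_integral_le_of_norm_le h0 ?_
      ((continuous_const.mul hg).intervalIntegrable _ _)
    filter_upwards [hu] with s hs hsr
    have hsT : s ∈ Icc 0 T := ⟨hsr.1.le, hsr.2.trans hrT.2⟩
    have hus := hs hsT
    have := hK.norm_sub_le (x := (historyAt Δ x s, u s)) (y := (historyAt Δ y s, u s))
      ⟨by simpa using hxR s hsT, by simpa using hus⟩
      ⟨by simpa using hyR s hsT, by simpa using hus⟩
    simpa [Prod.norm_def] using this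
  rw [hx.eq_integral r hrT, hy.eq_integral r hrT, add_sub_add_comm,
    ← intervalIntegral.integral_sub (hx.integrable r hrT) (hy.integrable r hrT)]
  refine (norm_add_le _ _).trans (add_le_add (hinit 0 (by simp)) (hint.trans ?_))
  rw [intervalIntegral.integral_const_mul]
  refine mul_le_mul_of_nonneg_left ?_ K.coe_nonneg
  exact intervalIntegral.integral_mono_interval le_rfl h0 hrt
    (ae_of_all _ fun _ => norm_nonneg _) (hg.intervalIntegrable _ _)

/-- Grönwall with zero initial difference. Equality is claimed for histories only, because
representatives are arbitrary outside `[-Δ, T]`. -/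
lemma IsSolution.historyAt_eq {T : ℝ} (hf : LipschitzOnBounded f) (hu : IsInput u)
    (hx : IsSolution f φ u (Icc 0 T) x) (hy : IsSolution f φ u (Icc 0 T) y) :
    ∀ t ∈ Icc 0 T, historyAt Δ x t = historyAt Δ y t := by
  intro t ht
  obtain ⟨R₁, hR₁⟩ := exists_norm_historyAt_le (Δ := Δ) x T
  obtain ⟨R₂, hR₂⟩ := exists_norm_historyAt_le (Δ := Δ) y T
  obtain ⟨K, hK⟩ := hf.exists_lipschitzOnWith (max R₁ R₂) (inputNorm u T)
  have := hx.norm_historyAt_sub_le hK hy (fun t ht => (hR₁ t ht).trans (le_max_left _ _))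
    (fun t ht => (hR₂ t ht).trans (le_max_right _ _)) (hu.ae_norm_le (ht.1.trans ht.2)) t ht
  rw [sub_self, norm_zero, zero_mul] at this
  exact sub_eq_zero.1 (norm_le_zero_iff.1 this)

/-- Restarting a solution at time `a`. -/
lemma IsSolution.timeShift {a T : ℝ} (ha : 0 ≤ a) (hT : 0 ≤ T)
    (hx : IsSolution f φ u (Icc 0 (T + a)) x) :
    IsSolution f (historyAt Δ x a) (fun s => u (s + a)) (Icc 0 T) (timeShift a x) := by
  have haT : a ∈ Icc 0 (T + a) := ⟨ha, by linarith⟩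
  have hshift : ∀ t ∈ Icc 0 T, t + a ∈ Icc 0 (T + a) := fun t ht =>
    ⟨add_nonneg ht.1 ha, by linarith [ht.2]⟩
  have hii : ∀ t ∈ Icc 0 T,
      IntervalIntegrable (fun s => f (historyAt Δ x s, u s)) volume a (t + a) := fun t ht =>
    (hx.integrable a haT).symm.trans (hx.integrable _ (hshift t ht))
  refine ⟨by simp [historyAt_timeShift], fun t ht => ?_, fun t ht => ?_⟩
  · simpa [historyAt_timeShift] using (hii t ht).comp_add_right a
  · simp only [historyAt_timeShift]
    rw [intervalIntegral.integral_comp_add_right (fun s => f (historyAt Δ x s, u s)) a, zero_add]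
    change x (t + a) = x (0 + a) + _
    rw [zero_add, hx.eq_integral _ (hshift t ht), hx.eq_integral a haT, add_assoc,
      intervalIntegral.integral_add_adjacent_intervals (hx.integrable a haT) (hii t ht)]

/-- Concatenation of a solution on `[0, a]` with a solution restarted at time `a`. -/
lemma IsSolution.exists_concat {a T : ℝ} (ha : 0 ≤ a) (hf : LipschitzOnBounded f)
    (hu : IsInput u) (hx : IsSolution f φ u (Icc 0 a) x)
    (hy : IsSolution f (historyAt Δ x a) (fun s => u (s + a)) (Icc 0 T) y) :
    ∃ z, IsSolution f φ u (Icc 0 (T + a)) z ∧ EqOn x z (Iic a) := by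
  have hxy : ∀ τ ∈ Icc (-(Δ : ℝ)) 0, x (a + τ) = y τ := fun τ hτ => (hy.apply_eq hτ).symm
  have hxya : x a = y 0 := by simpa using hxy 0 (by simp)
  let z : C(ℝ, EuclideanSpace ℝ (Fin n)) :=
    ⟨fun t => if t ≤ a then x t else y (t - a),
      Continuous.if_le (by fun_prop) (by fun_prop) continuous_id continuous_const
        fun t ht => by rw [show t = a from ht, sub_self, hxya]⟩
  have hzx : ∀ t ≤ a, z t = x t := fun t ht => if_pos ht
  -- The identity must reach back to `-Δ`, so that histories of `z` just after time `a` agree with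
  -- those of `y`.
  have hzy : ∀ t, -(Δ : ℝ) ≤ t → z (t + a) = y t := fun t ht => by
    rcases le_or_gt t 0 with h0 | h0
    · rw [hzx _ (by linarith), ← hxy t ⟨ht, h0⟩, add_comm]
    · exact (if_neg (by linarith)).trans (by rw [add_sub_cancel_right])
  have hhx : ∀ t ≤ a, historyAt Δ z t = historyAt Δ x t := fun t ht =>
    historyAt_congr fun τ hτ => hzx _ (by linarith [hτ.2])
  have hhy : ∀ t, 0 ≤ t → historyAt Δ z (t + a) = historyAt Δ y t := fun t ht =>
    historyAt_congr fun τ hτ => by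
      rw [add_right_comm]
      exact hzy _ (by linarith [hτ.1])
  have hint : ∀ t, 0 ≤ t →
      IntervalIntegrable (fun s => f (historyAt Δ z s, u s)) volume 0 t := fun t ht =>
    intervalIntegrable_vectorField hf hu z ht
  have hleft : ∀ t ∈ Icc 0 a, z t = z 0 + ∫ s in (0 : ℝ)..t, f (historyAt Δ z s, u s) :=
    fun t ht => by
      rw [hzx t ht.2, hzx 0 ha, hx.eq_integral t ht]
      congr 1
      refine intervalIntegral.integral_congr fun s hs => ?_
      rw [uIcc_of_le ht.1] at hs
      simp only [hhx s (hs.2.trans ht.2)]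
  refine ⟨z, ⟨(hhx 0 ha).trans hx.init, fun t ht => hint t ht.1, fun t ht => ?_⟩,
    fun t ht => (hzx t ht).symm⟩
  rcases le_total t a with hta | hta
  · exact hleft t ⟨ht.1, hta⟩
  obtain ⟨s, rfl⟩ : ∃ s, t = s + a := ⟨t - a, by ring⟩
  have hs0 : 0 ≤ s := by linarith
  rw [← intervalIntegral.integral_add_adjacent_intervals (hint a ha)
    ((hint a ha).symm.trans (hint _ ht.1)), ← add_assoc, ← hleft a ⟨ha, le_rfl⟩,
    hzy s (by linarith [Δ.coe_nonneg]), hy.eq_integral s ⟨hs0, by linarith [ht.2]⟩,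
    hzx a le_rfl, hxya]
  congr 1
  have := intervalIntegral.integral_comp_add_right (a := 0) (b := s)
    (fun s => f (historyAt Δ z s, u s)) a
  rw [zero_add] at this
  rw [← this]
  refine intervalIntegral.integral_congr fun r hr => ?_
  rw [uIcc_of_le hs0] at hr
  simp only [hhy r hr.1]

end Solutions

end DelaySystem

/-! ### Extension by density, global existence and the two implications -/

namespace DelaySystem

variable {Δ : ℝ≥0} {n m : ℕ}
  {f : History Δ n × EuclideanSpace ℝ (Fin m) → EuclideanSpace ℝ (Fin n)}
  {u : ℝ → EuclideanSpace ℝ (Fin m)} {φ : History Δ n}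
  {ℓ T lam : ℝ} {μ : ℝ≥0 → ℝ≥0}

/-- A limit of uniformly bounded solutions whose initial histories converge is a solution. -/
lemma exists_isSolution_of_tendsto (hf : LipschitzOnBounded f) (hu : IsInput u) (hT : 0 ≤ T)
    {ψ : ℕ → History Δ n} (hψ : Tendsto ψ atTop (𝓝 φ))
    {z : ℕ → C(ℝ, EuclideanSpace ℝ (Fin n))}
    (hz : ∀ j, IsSolution f (ψ j) u (Icc 0 T) (z j)) {R : ℝ}
    (hR : ∀ j, ∀ t ∈ Icc 0 T, ‖historyAt Δ (z j) t‖ ≤ R) :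
    ∃ x, IsSolution f φ u (Icc 0 T) x ∧
      ∀ t ∈ Icc 0 T, Tendsto (fun j => historyAt Δ (z j) t) atTop (𝓝 (historyAt Δ x t)) := by
  obtain ⟨K, hK⟩ := hf.exists_lipschitzOnWith R (inputNorm u T)
  have hΔT : -(Δ : ℝ) ≤ T := by linarith [Δ.coe_nonneg]
  let r : ℕ → C(Icc (-(Δ : ℝ)) T, EuclideanSpace ℝ (Fin n)) := fun j => (z j).restrict _
  -- Continuous dependence turns convergence of the initial histories into a Cauchy property on
  -- `[-Δ, T]`.
  have hdist : ∀ i j, dist (r i) (r j) ≤ dist (ψ i) (ψ j) * Real.exp (K * T) := fun i j => by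
    have hcomp : ∀ t ∈ Icc 0 T, ∀ τ ∈ Icc (-(Δ : ℝ)) 0,
        dist (z i (t + τ)) (z j (t + τ)) ≤ dist (ψ i) (ψ j) * Real.exp (K * T) :=
      fun t ht τ hτ => by
        have h1 := (hz i).norm_historyAt_sub_le hK (hz j) (hR i) (hR j) (hu.ae_norm_le hT) t ht
        have h2 := (historyAt Δ (z i) t - historyAt Δ (z j) t).norm_coe_le_norm ⟨τ, hτ⟩
        rw [dist_eq_norm, dist_eq_norm]
        refine (h2.trans h1).trans ?_
        gcongr
        exact ht.2
    refine (ContinuousMap.dist_le (by positivity)).2 fun t => ?_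
    change dist (z i t) (z j t) ≤ _
    rcases le_total (t : ℝ) 0 with h0 | h0
    · simpa using hcomp 0 ⟨le_rfl, hT⟩ t ⟨t.2.1, h0⟩
    · simpa using hcomp t ⟨h0, t.2.2⟩ 0 (by simp)
  have hcauchy : CauchySeq r := by
    rw [cauchySeq_iff_tendsto_dist_atTop_0]
    refine squeeze_zero (fun _ => dist_nonneg) (fun p => hdist p.1 p.2) ?_
    simpa using (cauchySeq_iff_tendsto_dist_atTop_0.1 hψ.cauchySeq).mul_const (Real.exp (K * T))
  obtain ⟨q, hq⟩ := cauchySeq_tendsto_of_complete hcauchy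
  let x : C(ℝ, EuclideanSpace ℝ (Fin n)) := ⟨IccExtend hΔT q, q.continuous.Icc_extend'⟩
  have hlim : ∀ t ∈ Icc 0 T,
      Tendsto (fun j => historyAt Δ (z j) t) atTop (𝓝 (historyAt Δ x t)) := fun t ht => by
    refine tendsto_iff_dist_tendsto_zero.2 <| squeeze_zero (fun _ => dist_nonneg) (fun j => ?_)
      (tendsto_iff_dist_tendsto_zero.1 hq)
    refine (ContinuousMap.dist_le dist_nonneg).2 fun τ => ?_
    have hmem : t + (τ : ℝ) ∈ Icc (-(Δ : ℝ)) T :=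
      ⟨by linarith [ht.1, τ.2.1], by linarith [ht.2, τ.2.2]⟩
    have hx : historyAt Δ x t τ = q ⟨t + τ, hmem⟩ := IccExtend_of_mem hΔT q hmem
    rw [hx]
    exact ContinuousMap.dist_apply_le_dist (f := r j) (g := q) ⟨t + τ, hmem⟩
  have hval : ∀ t ∈ Icc 0 T, Tendsto (fun j => z j t) atTop (𝓝 (x t)) := fun t ht => by
    simpa [Function.comp_def] using
      ((continuous_eval_const (⟨0, by simp⟩ : Icc (-(Δ : ℝ)) 0)).tendsto _).comp (hlim t ht)
  have h0T : (0 : ℝ) ∈ Icc 0 T := ⟨le_rfl, hT⟩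
  refine ⟨x, ⟨?_, fun t ht => intervalIntegrable_vectorField hf hu x ht.1, fun t ht => ?_⟩, hlim⟩
  · refine tendsto_nhds_unique (hlim 0 h0T) ?_
    simpa only [(hz _).init] using hψ
  obtain ⟨C, hC⟩ := exists_norm_vectorField_le hf hu hT R
  have hsub : uIoc 0 t ⊆ Icc 0 T := by
    rw [uIoc_of_le ht.1]
    exact Ioc_subset_Icc_self.trans (Icc_subset_Icc_right ht.2)
  have hint : Tendsto (fun j => ∫ s in (0 : ℝ)..t, f (historyAt Δ (z j) s, u s)) atTop
      (𝓝 (∫ s in (0 : ℝ)..t, f (historyAt Δ x s, u s))) := by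
    refine intervalIntegral.tendsto_integral_filter_of_dominated_convergence (fun _ => C)
      (.of_forall fun j => ?_) (.of_forall fun j => ?_) intervalIntegrable_const
      (ae_of_all _ fun s hs => ?_)
    · exact (aestronglyMeasurable_vectorField hf hu (z j) hT).mono_measure
        (Measure.restrict_mono hsub le_rfl)
    · filter_upwards [hC] with s hs hst using hs (hsub hst) _ (hR j s (hsub hst))
    · exact (hf.continuous.tendsto _).comp ((hlim s (hsub hs)).prodMk_nhds tendsto_const_nhds)
  refine tendsto_nhds_unique (hval t ht) (((hval 0 h0T).add hint).congr fun j => ?_)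
  exact ((hz j).eq_integral t ht).symm

/-- By density, the finite time estimates extend from `W^{1,∞}` to all initial histories. -/
lemma FiniteTimeEstimates.of_continuous (hf : LipschitzOnBounded f) (hℓ : 0 < ℓ) (hT : 0 < T)
    (hμ : Monotone μ) (h : FiniteTimeEstimates f ℓ T lam μ) (φ : History Δ n)
    (hu : IsInput u) :
    SolutionSatisfies f φ u (Icc 0 T) fun x =>
      (∀ t ∈ Icc (0 : ℝ) T, ‖historyAt Δ x t‖ ≤ ℓ * ‖φ‖ + μ (inputNorm u t)) ∧
      ‖historyAt Δ x T‖ ≤ lam * ‖φ‖ + μ (inputNorm u T) := by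
  obtain ⟨ψ, hψ, hlimψ⟩ := exists_seq_isSobolev_tendsto φ
  choose z hz using fun j => (h (ψ j) u (hψ j) hu).1
  have hest := fun j => (h (ψ j) u (hψ j) hu).2 (z j) (hz j)
  obtain ⟨C, hC⟩ := (Metric.isBounded_range_of_tendsto ψ hlimψ).exists_norm_le
  have hbound : ∀ j, ∀ t ∈ Icc 0 T,
      ‖historyAt Δ (z j) t‖ ≤ ℓ * C + μ (inputNorm u T) := fun j t ht => by
    refine ((hest j).1 t ht).trans (add_le_add ?_ ?_)
    · exact mul_le_mul_of_nonneg_left (hC _ (mem_range_self j)) hℓ.le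
    · exact_mod_cast hμ (hu.inputNorm_mono hT.le ht.2)
  obtain ⟨x, hx, hlim⟩ := exists_isSolution_of_tendsto hf hu hT.le hlimψ hz hbound
  refine ⟨⟨x, hx⟩, fun y hy => ?_⟩
  have hyx := hy.historyAt_eq hf hu hx
  have hTT : T ∈ Icc 0 T := ⟨hT.le, le_rfl⟩
  refine ⟨fun t ht => ?_, ?_⟩
  · rw [hyx t ht]
    exact le_of_tendsto_of_tendsto' (hlim t ht).norm ((hlimψ.norm.const_mul ℓ).add_const _)
      fun j => (hest j).1 t ht
  · rw [hyx T hTT]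
    exact le_of_tendsto_of_tendsto' (hlim T hTT).norm ((hlimψ.norm.const_mul lam).add_const _)
      fun j => (hest j).2

/-- If every initial history admits a solution on a time interval of fixed length, then solutions
exist for all times. -/
lemma exists_isSolution_Ici (hf : LipschitzOnBounded f) (hT : 0 < T)
    (hex : ∀ (φ : History Δ n) (u : ℝ → EuclideanSpace ℝ (Fin m)), IsInput u →
      ∃ x, IsSolution f φ u (Icc 0 T) x) (φ : History Δ n) (hu : IsInput u) :
    ∃ x, IsSolution f φ u (Ici 0) x := by
  have hjT : ∀ j : ℕ, 0 ≤ (j : ℝ) * T := fun j => by positivity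
  -- Bundling the solution property in a subtype lets the chosen extension be iterated by recursion.
  have step : ∀ (j : ℕ) (x : {x // IsSolution f φ u (Icc 0 (j * T)) x}),
      ∃ z : {z // IsSolution f φ u (Icc 0 ((j + 1 : ℕ) * T)) z},
        EqOn x.1 z.1 (Iic (j * T)) := fun j x => by
    obtain ⟨y, hy⟩ := hex (historyAt Δ x.1 (j * T)) _ (hu.comp_add_right (hjT j))
    obtain ⟨z, hz, hxz⟩ := x.2.exists_concat (hjT j) hf hu hy
    refine ⟨⟨z, ?_⟩, hxz⟩
    convert hz using 2
    push_cast
    ring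
  choose next hnext using step
  have base : ∃ x, IsSolution f φ u (Icc 0 ((0 : ℕ) * T)) x := by
    obtain ⟨x, hx⟩ := hex φ u hu
    exact ⟨x, hx.mono (Icc_subset_Icc_right (by simpa using hT.le))⟩
  let X : (j : ℕ) → {x // IsSolution f φ u (Icc 0 (j * T)) x} := fun j =>
    Nat.rec ⟨base.choose, base.choose_spec⟩ next j
  have hX : ∀ i j, i ≤ j → EqOn (X i).1 (X j).1 (Iic (i * T)) := fun i j hij => by
    induction j, hij using Nat.le_induction with
    | base => exact fun _ _ => rfl
    | succ j hij ih =>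
      refine ih.trans ((hnext j (X j)).mono (Iic_subset_Iic.2 ?_))
      gcongr
  have hceil : ∀ t : ℝ, t ≤ ⌈t / T⌉₊ * T := fun t => (div_le_iff₀ hT).1 (Nat.le_ceil _)
  -- The glued function reads off piece `⌈t / T⌉₊` (piece `0` for negative `t`); by consistency
  -- every later piece gives the same value.
  have hglue : ∀ (j : ℕ) (t : ℝ), t ≤ j * T → (X ⌈t / T⌉₊).1 t = (X j).1 t := fun j t ht =>
    hX _ j (Nat.ceil_le.2 ((div_le_iff₀ hT).2 ht)) (hceil t)
  have hcont : Continuous fun t => (X ⌈t / T⌉₊).1 t := continuous_iff_continuousAt.2 fun t => by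
    obtain ⟨j, hj⟩ := exists_nat_gt (t / T)
    have hloc : (X j).1 =ᶠ[𝓝 t] fun t => (X ⌈t / T⌉₊).1 t := by
      filter_upwards [Iio_mem_nhds ((div_lt_iff₀ hT).1 hj)] with s hs
      exact (hglue j s (le_of_lt hs)).symm
    exact (X j).1.continuous.continuousAt.congr hloc
  let x : C(ℝ, EuclideanSpace ℝ (Fin n)) := ⟨_, hcont⟩
  have hxX : ∀ (j : ℕ), ∀ t ≤ j * T, historyAt Δ x t = historyAt Δ (X j).1 t := fun j t ht =>
    historyAt_congr fun τ hτ => hglue j _ (by linarith [hτ.2])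
  refine ⟨x, (hxX 0 0 (by simp)).trans (X 0).2.init,
    fun t ht => intervalIntegrable_vectorField hf hu x ht, fun t ht => ?_⟩
  have ht0 : (0 : ℝ) ≤ t := ht
  have key := (X ⌈t / T⌉₊).2.eq_integral t ⟨ht0, hceil t⟩
  rw [← hglue _ 0 (hjT _)] at key
  refine key.trans ?_
  change x 0 + _ = x 0 + _
  congr 1
  refine intervalIntegral.integral_congr fun s hs => ?_
  rw [uIcc_of_le ht0] at hs
  simp only [hxX _ s (hs.2.trans (hceil t))]

/-- The finite time estimates imply exponential input-to-state stability, with a gain that is a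
constant multiple of the given one. -/
lemma FiniteTimeEstimates.exists_expISSWithGain (hf : LipschitzOnBounded f) (hℓ : 0 < ℓ)
    (hT : 0 < T) (hlam : lam ∈ Ioo (0 : ℝ) 1) (hμ : Monotone μ)
    (h : FiniteTimeEstimates f ℓ T lam μ) :
    ∃ c : ℝ≥0, ExpISSWithGain f fun s => c * μ s := by
  obtain ⟨hlam0, hlam1⟩ := hlam
  have h1lam : 0 < 1 - lam := sub_pos.2 hlam1
  have hest := fun (φ : History Δ n) u hu =>
    FiniteTimeEstimates.of_continuous (u := u) hf hℓ hT hμ h φ hu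
  have hc : 0 ≤ ℓ / (1 - lam) + 1 := by positivity
  -- With `j = ⌊t / T⌋₊ ≥ t / T - 1`, `lam ^ j` is at most `lam⁻¹` times the exponential of rate
  -- `-log lam / T`. The gain constant is `ℓ` times the geometric sum, plus one for the last window.
  refine ⟨(ℓ / (1 - lam) + 1).toNNReal, ℓ / lam, -Real.log lam / T, by positivity,
    div_pos (neg_pos.2 (Real.log_neg hlam0 hlam1)) hT, fun φ u hu =>
    ⟨exists_isSolution_Ici hf hT (fun φ u hu => (hest φ u hu).1) φ hu, fun x hx => ?_⟩⟩
  have hjT : ∀ j : ℕ, 0 ≤ (j : ℝ) * T := fun j => by positivity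
  have hwindow := fun j : ℕ => (hest _ _ (hu.comp_add_right (hjT j))).2 _
    ((hx.mono Icc_subset_Ici_self).timeShift (hjT j) hT.le)
  simp only [historyAt_timeShift] at hwindow
  have hμle : ∀ {s t : ℝ}, 0 ≤ t → s ≤ t → (μ (inputNorm u s) : ℝ) ≤ μ (inputNorm u t) :=
    fun ht hst => by exact_mod_cast hμ (hu.inputNorm_mono ht hst)
  have hμshift : ∀ (j : ℕ) {t : ℝ}, 0 ≤ t →
      (μ (inputNorm (fun s => u (s + j * T)) t) : ℝ) ≤ μ (inputNorm u (t + j * T)) :=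
    fun j t ht => by exact_mod_cast hμ (hu.inputNorm_comp_add_right_le (hjT j) ht)
  -- `M / (1 - lam)` is the fixed point of `v ↦ lam * v + M`, so the input term reproduces itself in
  -- the induction.
  have hsample : ∀ j : ℕ, ‖historyAt Δ x (j * T)‖ ≤
      lam ^ j * ‖φ‖ + μ (inputNorm u (j * T)) / (1 - lam) := fun j => by
    induction j with
    | zero =>
      rw [Nat.cast_zero, zero_mul, hx.init, pow_zero, one_mul]
      exact le_add_of_nonneg_right (by positivity)
    | succ j ih =>
      have hstep := (hwindow j).2
      have hsucc : T + j * T = (j + 1 : ℕ) * T := by push_cast; ring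
      have hsh := hμshift j hT.le
      rw [hsucc] at hstep hsh
      have hle : (j : ℝ) * T ≤ (j + 1 : ℕ) * T := by rw [← hsucc]; linarith
      have hm := hμle (hjT (j + 1)) hle
      set M : ℝ := (μ (inputNorm u ((j + 1 : ℕ) * T)) : ℝ)
      calc _ ≤ _ := hstep
        _ ≤ lam * (lam ^ j * ‖φ‖ + M / (1 - lam)) + M := by
          gcongr
          exact ih.trans (by gcongr)
        _ = _ := by field_simp; ring
  intro t ht
  set j := ⌊t / T⌋₊
  have hjt : (j : ℝ) * T ≤ t := (le_div_iff₀ hT).1 (Nat.floor_le (by positivity))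
  have htj : t / T ≤ (j : ℝ) + 1 := (Nat.lt_floor_add_one _).le
  have htj' : t ≤ (j + 1) * T := (div_le_iff₀ hT).1 htj
  have hwin := (hwindow j).1 (t - j * T) ⟨by linarith, by linarith⟩
  have hsh := hμshift j (t := t - j * T) (by linarith)
  rw [sub_add_cancel] at hwin hsh
  have hm := hμle ht hjt
  have hpow : lam ^ j ≤ lam⁻¹ * Real.exp (-(-Real.log lam / T) * t) := by
    rw [le_inv_mul_iff₀ hlam0, ← pow_succ']
    calc lam ^ (j + 1) = lam ^ ((j : ℝ) + 1) := by rw [← Real.rpow_natCast]; push_cast; rfl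
      _ ≤ lam ^ (t / T) := Real.rpow_le_rpow_of_exponent_ge hlam0 hlam1.le htj
      _ = _ := by rw [Real.rpow_def_of_pos hlam0]; congr 1; ring
  have hsam := hsample j
  rw [NNReal.coe_mul, Real.coe_toNNReal _ hc]
  set M : ℝ := (μ (inputNorm u t) : ℝ)
  calc ‖x t‖ ≤ ‖historyAt Δ x t‖ := norm_apply_le_norm_historyAt x t
    _ ≤ _ := hwin
    _ ≤ ℓ * (lam⁻¹ * Real.exp (-(-Real.log lam / T) * t) * ‖φ‖ + M / (1 - lam)) + M := by
      gcongr
      exact hsam.trans (by gcongr)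
    _ = _ := by field_simp; ring

/-- Exponential input-to-state stability implies the finite time estimates with the same gain. -/
lemma ExpISSWithGain.exists_finiteTimeEstimates (hf : LipschitzOnBounded f) (hμ : Monotone μ)
    (h : ExpISSWithGain f μ) :
    ∃ ℓ T lam : ℝ, 0 < ℓ ∧ 0 < T ∧ lam ∈ Ioo (0 : ℝ) 1 ∧ FiniteTimeEstimates f ℓ T lam μ := by
  obtain ⟨k, η, hk, hη, h⟩ := h
  have hS : 0 < 2 * k / η := by positivity
  have hT : 0 < Δ + 2 * k / η := by positivity
  -- The window ending at this `T` starts at `2 * k / η`, where the factor is at most `k * exp (-2k)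
  -- ≤ 1 / 2`. The `1` in `max k 1` covers the times at which the history still shows `φ`.
  refine ⟨max k 1, Δ + 2 * k / η, 1 / 2, by positivity, hT, by norm_num, fun φ u _ hu => ?_⟩
  obtain ⟨⟨y, hy⟩, hest⟩ := h φ u hu
  have hyT := hy.mono (Icc_subset_Ici_self (a := Δ + 2 * k / η) (b := 0))
  refine ⟨⟨y, hyT⟩, fun x hx => ?_⟩
  -- `x` solves the equation only on `[0, T]`; uniqueness transfers to it the estimate for the
  -- global solution `y`.
  have hxy := hx.historyAt_eq hf hu hyT
  have hbound := hest y hy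
  have hμle : ∀ {s t : ℝ}, 0 ≤ t → s ≤ t → (μ (inputNorm u s) : ℝ) ≤ μ (inputNorm u t) :=
    fun ht hst => by exact_mod_cast hμ (hu.inputNorm_mono ht hst)
  refine ⟨fun t ht => ?_, ?_⟩
  · rw [hxy t ht, ContinuousMap.norm_le _ (by positivity)]
    intro τ
    rw [historyAt_apply]
    rcases le_total (t + τ : ℝ) 0 with h0 | h0
    · rw [hy.apply_eq ⟨by linarith [τ.2.1, ht.1], h0⟩]
      refine (φ.norm_coe_le_norm _).trans (le_add_of_le_of_nonneg ?_ NNReal.zero_le_coe)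
      exact le_mul_of_one_le_left (norm_nonneg _) (le_max_right _ _)
    · refine (hbound _ h0).trans (add_le_add ?_ (hμle ht.1 (by linarith [τ.2.2])))
      have hexp : Real.exp (-η * (t + τ)) ≤ 1 := Real.exp_le_one_iff.2 (by nlinarith)
      calc k * ‖φ‖ * Real.exp (-η * (t + τ)) ≤ k * ‖φ‖ * 1 := by gcongr
        _ ≤ max k 1 * ‖φ‖ := by rw [mul_one]; gcongr; exact le_max_left _ _
  · rw [hxy _ ⟨hT.le, le_rfl⟩, ContinuousMap.norm_le _ (by positivity)]
    intro τ
    rw [historyAt_apply]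
    have hτ : 2 * k / η ≤ Δ + 2 * k / η + τ := by linarith [τ.2.1]
    refine (hbound _ (hS.le.trans hτ)).trans
      (add_le_add ?_ (hμle hT.le (by linarith [τ.2.2])))
    have hexp : k * Real.exp (-η * (Δ + 2 * k / η + τ)) ≤ 1 / 2 := by
      have hle : -η * (Δ + 2 * k / η + τ) ≤ -(2 * k) := by
        have := (div_le_iff₀ hη).1 hτ
        linarith
      calc k * Real.exp (-η * (Δ + 2 * k / η + τ)) ≤ k * Real.exp (-(2 * k)) := by gcongr
        _ = k / Real.exp (2 * k) := by rw [Real.exp_neg, div_eq_mul_inv]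
        _ ≤ 1 / 2 := by
          rw [div_le_iff₀ (Real.exp_pos _)]
          linarith [Real.add_one_le_exp (2 * k)]
    calc _ = k * Real.exp (-η * (Δ + 2 * k / η + τ)) * ‖φ‖ := by ring
      _ ≤ 1 / 2 * ‖φ‖ := by gcongr

lemma IsClassN.const_mul (hμ : IsClassN μ) (c : ℝ≥0) : IsClassN fun s => c * μ s where
  continuous := continuous_const.mul hμ.continuous
  monotone := fun _ _ hst => mul_le_mul_right (hμ.monotone hst) c
  map_zero := by rw [hμ.map_zero, mul_zero]

lemma IsLinearGain.const_mul (hμ : IsLinearGain μ) (c : ℝ≥0) :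
    IsLinearGain fun s => c * μ s := by
  obtain ⟨μ₀, h⟩ := hμ
  exact ⟨c * μ₀, fun s => by simp only [h, mul_assoc]⟩

end DelaySystem

theorem mainTheorem5 (Δ : ℝ≥0) (n m : ℕ)
    (f : DelaySystem.History Δ n × EuclideanSpace ℝ (Fin m) → EuclideanSpace ℝ (Fin n))
    (hf : DelaySystem.LipschitzOnBounded f) (hf0 : f (0, 0) = 0) :
    (DelaySystem.ExpISS f ↔
      ∃ (ℓ T lam : ℝ) (μ : ℝ≥0 → ℝ≥0), 0 < ℓ ∧ 0 < T ∧ lam ∈ Set.Ioo (0 : ℝ) 1 ∧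
        DelaySystem.IsClassN μ ∧ DelaySystem.FiniteTimeEstimates f ℓ T lam μ) ∧
    (DelaySystem.ExpISSLinearGain f ↔
      ∃ (ℓ T lam : ℝ) (μ : ℝ≥0 → ℝ≥0), 0 < ℓ ∧ 0 < T ∧ lam ∈ Set.Ioo (0 : ℝ) 1 ∧
        DelaySystem.IsClassN μ ∧ DelaySystem.IsLinearGain μ ∧
        DelaySystem.FiniteTimeEstimates f ℓ T lam μ) := by
  refine ⟨⟨?_, ?_⟩, ⟨?_, ?_⟩⟩
  · rintro ⟨μ, hμ, h⟩
    obtain ⟨ℓ, T, lam, hℓ, hT, hlam, hest⟩ := h.exists_finiteTimeEstimates hf hμ.monotone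
    exact ⟨ℓ, T, lam, μ, hℓ, hT, hlam, hμ, hest⟩
  · rintro ⟨ℓ, T, lam, μ, hℓ, hT, hlam, hμ, hest⟩
    obtain ⟨c, h⟩ := hest.exists_expISSWithGain hf hℓ hT hlam hμ.monotone
    exact ⟨_, hμ.const_mul c, h⟩
  · rintro ⟨μ, hμ, hlin, h⟩
    obtain ⟨ℓ, T, lam, hℓ, hT, hlam, hest⟩ := h.exists_finiteTimeEstimates hf hμ.monotone
    exact ⟨ℓ, T, lam, μ, hℓ, hT, hlam, hμ, hlin, hest⟩
  · rintro ⟨ℓ, T, lam, μ, hℓ, hT, hlam, hμ, hlin, hest⟩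
    obtain ⟨c, h⟩ := hest.exists_expISSWithGain hf hℓ hT hlam hμ.monotone
    exact ⟨_, hμ.const_mul c, hlin.const_mul c, h⟩
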